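/- Let $(A,h)$ be a Euclidean vector space of dimension $n\ge 2$. Homogeneous cubic polynomials $P$ on $A$ are considered that solve $$\Delta_h P=0,\qquad |\mathrm{Hess}\,P|_h^2=\kappa\,|x|_h^2 \qquad (\ast)$$ for some real constant $\kappa\neq 0$. Write $P_{ijk}=D_iD_jD_kP$, with indices raised by $h$. A solution $P$ of $(\ast)$ with constant $\kappa$ is called conformally associative if $$P_{li}{}^{p}P_{jkp}-P_{lj}{}^{p}P_{ikp}=\tfrac{\kappa}{n-1}\left(h_{ki}h_{jl}-h_{kj}h_{il}\right).$$ The group $CO(h)=GL(1,\mathbb R)\times O(h)$ (nonzero homotheties times orthogonal maps) acts by $(g\cdot P)(x)=P(g^{-1}x)$. The automorphism group $\mathrm{Aut}(P)$ consists of the $g\in O(h)$ with $g\cdot P=P$. $P$ is orthogonally decomposable if there is a subspace $\{0\}\neq U\subsetneq A$ such that $P(x+y)=P(x)+P(y)$ for all $x\in U$, $y\in U^{\perp}$, and orthogonally indecomposable otherwise. In coordinates $x_1,\dots,x_n$ with respect to an $h$-orthonormal basis, let $$P_n(x)=\tfrac{\sqrt{n(n+1)}}{6}\sum_{j=2}^{n}\tfrac{1}{\sqrt{j(j+1)}}\sum_{i=1}^{j-1}\left(x_j^3-3x_jx_i^2\right).$$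 Theorem. (1) $P_n$ is a conformally associative solution of $(\ast)$ with $\kappa=n(n-1)$. (2) The conformally associative solutions of $(\ast)$, for all constants $\kappa\ne0$ together, form exactly one $CO(h)$-orbit, namely the orbit of $P_n$. (3) Every $P$ in this orbit is orthogonally indecomposable. (4) For every $P$ in this orbit, $\mathrm{Aut}(P)$ maps the set of critical points of the restriction of $P$ to the unit sphere onto itself. The set $M(P)$ of points where this restriction attains its maximum has exactly $n+1$ elements $v_0,\dots,v_n$, and the action of $\mathrm{Aut}(P)$ on them is an isomorphism of $\mathrm{Aut}(P)$ onto the symmetric group $S_{n+1}$ of all permutations of $M(P)$. For $i\neq j$ the polynomial $P$ vanishes on the line spanned by $v_i-v_j$, and the transposition of $v_i$ and $v_j$ is induced by the orthogonal reflection through the hyperplane orthogonal to this line. $\mathrm{Aut}(P)$ is generated by these reflections. -/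

import Mathlib

namespace CubicPoly

noncomputable section

section Euclidean

variable {A : Type*} [NormedAddCommGroup A] [InnerProductSpace ℝ A]

/-- `P` is a homogeneous cubic polynomial on `A`: it is the polynomial `6 P(x) = ω(x, x, x)` of a
symmetric trilinear form `ω` (in finite dimensions continuity of `ω` is automatic). -/
def IsCubicForm (P : A → ℝ) : Prop :=
  ∃ ω : ContinuousMultilinearMap ℝ (fun _ : Fin 3 => A) ℝ,
    (∀ (σ : Equiv.Perm (Fin 3)) (v : Fin 3 → A), ω (fun i => v (σ i)) = ω v) ∧
    ∀ x : A, 6 * P x = ω (fun _ => x)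

/-- The Hessian of `P` at `x`, as a bilinear expression in `u`, `v`. -/
def hess (P : A → ℝ) (x u v : A) : ℝ := iteratedFDeriv ℝ 2 P x ![u, v]

/-- The third derivative `P_{ijk}` of `P` at `x`, contracted with `u^i v^j w^k`. -/
def third (P : A → ℝ) (x u v w : A) : ℝ := iteratedFDeriv ℝ 3 P x ![u, v, w]

/-- The squared norm of the Hessian of `P` at `x` for the Euclidean metric. -/
def hessNormSq [FiniteDimensional ℝ A] (P : A → ℝ) (x : A) : ℝ :=
  ∑ i, ∑ j, (hess P x (stdOrthonormalBasis ℝ A i) (stdOrthonormalBasis ℝ A j)) ^ 2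

/-- The cubic form `P` is harmonic and satisfies `|Hess P|² = κ |x|²`, with `κ ≠ 0`. -/
structure IsSolution [FiniteDimensional ℝ A] (P : A → ℝ) (κ : ℝ) : Prop where
  cubic : IsCubicForm P
  kappa_ne_zero : κ ≠ 0
  harmonic : ∀ x : A, (Laplacian.laplacian P : A → ℝ) x = 0
  hess_sq : ∀ x : A, hessNormSq P x = κ * ‖x‖ ^ 2

/-- The nonassociativity tensor
`P_{li}^p P_{jkp} - P_{lj}^p P_{ikp}` contracted with `u^i v^j w^k z^l`, at the point `x`. -/
def nonassoc [FiniteDimensional ℝ A] (P : A → ℝ) (x u v w z : A) : ℝ :=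
  ∑ p, (third P x z u (stdOrthonormalBasis ℝ A p) * third P x v w (stdOrthonormalBasis ℝ A p)
    - third P x z v (stdOrthonormalBasis ℝ A p) * third P x u w (stdOrthonormalBasis ℝ A p))

/-- `P` is a conformally associative solution with constant `κ`: it is a solution with constant `κ`
and `P_{li}^p P_{jkp} - P_{lj}^p P_{ikp} = κ / (n - 1) * (h_{ki} h_{jl} - h_{kj} h_{il})`. -/
structure IsConfAssocSolution [FiniteDimensional ℝ A] (P : A → ℝ) (κ : ℝ) : Prop where
  solution : IsSolution P κ
  confAssoc : ∀ x u v w z : A, nonassoc P x u v w z =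
    κ / ((Module.finrank ℝ A : ℝ) - 1) *
      (inner ℝ w u * inner ℝ v z - inner ℝ w v * inner ℝ u z)

variable (A) in
/-- The conformal linear group `CO(h) = GL(1, ℝ) × O(h)`, as a group of linear automorphisms: the
maps `x ↦ r • o x` with `r ≠ 0` real and `o` orthogonal. -/
def conformalGroup : Subgroup (A ≃ₗ[ℝ] A) where
  carrier := {g | ∃ (r : ℝ) (o : A ≃ₗᵢ[ℝ] A), r ≠ 0 ∧ ∀ x, g x = r • o x}
  one_mem' := ⟨1, 1, one_ne_zero, fun x => by simp⟩
  mul_mem' := by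
    rintro g g' ⟨r, o, hr, h⟩ ⟨r', o', hr', h'⟩
    refine ⟨r * r', o * o', mul_ne_zero hr hr', fun x => ?_⟩
    simp [h, h', mul_smul]
  inv_mem' := by
    rintro g ⟨r, o, hr, h⟩
    refine ⟨r⁻¹, o⁻¹, inv_ne_zero hr, fun x => ?_⟩
    apply g.injective
    change g (g.symm x) = g (r⁻¹ • o.symm x)
    rw [h (r⁻¹ • o.symm x)]
    simp [hr]

/-- The `CO(h)`-orbit of `P` under the action `(g · P)(x) = P(g⁻¹ x)`. -/
def orbit (P : A → ℝ) : Set (A → ℝ) :=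
  {Q | ∃ g ∈ conformalGroup A, Q = fun x => P (g⁻¹ x)}

/-- The automorphism group of `P`: the orthogonal transformations that preserve `P`. -/
def Aut (P : A → ℝ) : Subgroup (A ≃ₗᵢ[ℝ] A) where
  carrier := {g | ∀ x, P (g x) = P x}
  one_mem' := fun _ => rfl
  mul_mem' := by
    intro g g' h h' x
    exact (h (g' x)).trans (h' x)
  inv_mem' := by
    intro g h x
    have := h (g⁻¹ x)
    change P (g (g.symm x)) = P (g⁻¹ x) at this
    rw [← this, g.apply_symm_apply]

/-- `P` is orthogonally indecomposable: there is no nontrivial orthogonal splitting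
`A = U ⊕ Uᗮ` with `P(x + y) = P(x) + P(y)` for `x ∈ U`, `y ∈ Uᗮ`. -/
def OrthIndecomposable (P : A → ℝ) : Prop :=
  ¬ ∃ U : Submodule ℝ A, U ≠ ⊥ ∧ U ≠ ⊤ ∧ ∀ x ∈ U, ∀ y ∈ Uᗮ, P (x + y) = P x + P y

/-- The points of the unit sphere at which the restriction of `P` to it is maximal. -/
def sphereMaxima (P : A → ℝ) : Set A :=
  {v | ‖v‖ = 1 ∧ ∀ w : A, ‖w‖ = 1 → P w ≤ P v}

/-- The critical points of the restriction of `P` to the unit sphere. -/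
def sphereCritical (P : A → ℝ) : Set A :=
  {v | ‖v‖ = 1 ∧ ∀ w : A, inner ℝ v w = 0 → fderiv ℝ P v w = 0}

/-- The orthogonal reflection through the hyperplane orthogonal to `r`. -/
def hyperplaneReflection (r : A) : A ≃ₗᵢ[ℝ] A := (ℝ ∙ r)ᗮ.reflection

/-- The simplicial polynomial `P_n` in the coordinates of an orthonormal basis. The index `j : Fin n`
stands for the coordinate with number `j + 1`, so that the factor `1 / √(j (j + 1))` of the usual
numbering is `1 / √((j + 1) (j + 2))` here. -/
def simplicial {n : ℕ} (b : OrthonormalBasis (Fin n) ℝ A) (x : A) : ℝ :=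
  √((n : ℝ) * (n + 1)) / 6 * ∑ j : Fin n, 1 / √(((j : ℝ) + 1) * (j + 2)) *
    ∑ i ∈ Finset.Iio j, ((b.repr x j) ^ 3 - 3 * b.repr x j * (b.repr x i) ^ 2)

end Euclidean

end

end CubicPoly

/-! ### Polarization of cubic forms -/

namespace CubicPoly
section
variable {A : Type*} [NormedAddCommGroup A] [InnerProductSpace ℝ A]

/-! All solutions have one normal form, `IsSimplexForm`: a positive multiple of `∑ t_i ^ 3`, where
`t_0, …, t_n` are the coordinates of `A` realised as the sum-zero hyperplane of `ℝ^(n+1)`.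

Such a form is a solution because its product is coordinatewise multiplication, which is
associative, followed by projection to the hyperplane; the projection accounts for the curvature
term (`isConfAssocSolution`). The recursive construction of orthonormal coordinates on the
hyperplane turns `∑ t_i ^ 3` into `P_n` (`isSimplexForm_simplicial`).

Conversely, adjoining a unit to the algebra of `P`, with scaling `s ^ 2 = κ / (n - 1)`, absorbs the
curvature term: the multiplications `extMul` commute, are symmetric, and are traceless because `P`
is harmonic. A joint orthonormal eigenbasis has `n + 1` members, tracelessness makes their scalar
components equal up to sign, and their projections to `A` are, up to sign and scale, the vertices of
a regular simplex (`exists_isSimplexForm`).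

Two simplex forms differ by an isometry and a homothety, so there is one orbit. The maxima on the
sphere are the vertices of the simplex, so automorphisms permute them; every permutation of
coordinates is realised, and transpositions are reflections. -/

/-- A symmetric trilinear form `B`, in curried form, whose cubic polynomial is `P`. -/
structure IsPolarization (P : A → ℝ) (B : A →L[ℝ] A →L[ℝ] A →L[ℝ] ℝ) : Prop where
  swap_left : ∀ x y z, B x y z = B y x z
  swap_right : ∀ x y z, B x y z = B x z y
  apply_diag : ∀ x, 6 * P x = B x x x

lemma IsCubicForm.exists_isPolarization {P : A → ℝ} (h : IsCubicForm P) :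
    ∃ B, IsPolarization P B := by
  obtain ⟨ω, hs, hd⟩ := h
  let e := (continuousMultilinearCurryFin1 ℝ A ℝ).toContinuousLinearEquiv.toContinuousLinearMap
  let B : A →L[ℝ] A →L[ℝ] A →L[ℝ] ℝ :=
    (ContinuousLinearMap.compL ℝ A _ _ e).comp
      ((continuousMultilinearCurryLeftEquiv ℝ (fun _ : Fin 2 => A)
        ℝ).toContinuousLinearEquiv.toContinuousLinearMap.comp ω.curryLeft)
  have hB : ∀ x y z, B x y z = ω ![x, y, z] := by
    intro x y z
    change ω _ = _
    congr 1
    ext i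
    fin_cases i <;> rfl
  refine ⟨B, ?_, ?_, ?_⟩
  · intro x y z
    rw [hB, hB, ← hs (Equiv.swap 0 1)]
    congr 1
    ext i
    fin_cases i <;> rfl
  · intro x y z
    rw [hB, hB, ← hs (Equiv.swap 1 2)]
    congr 1
    ext i
    fin_cases i <;> rfl
  · intro x
    rw [hB, hd]
    congr 1
    ext i
    fin_cases i <;> rfl

namespace IsPolarization

variable {P : A → ℝ} {B : A →L[ℝ] A →L[ℝ] A →L[ℝ] ℝ} (h : IsPolarization P B)
include h

lemma hasFDerivAt (x : A) : HasFDerivAt P ((1 / 2 : ℝ) • B x x) x := by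
  have h1 : HasFDerivAt (fun y => (1 / 6 : ℝ) * B y y y) _ x :=
    (((B.hasFDerivAt (x := x)).clm_apply (hasFDerivAt_id x)).clm_apply
      (hasFDerivAt_id x)).const_mul (1 / 6 : ℝ)
  have h2 : P = fun y => (1 / 6 : ℝ) * B y y y := by
    ext y
    rw [← h.apply_diag]
    ring
  rw [h2]
  refine h1.congr_fderiv ?_
  ext v
  simp
  rw [h.swap_left v x x, h.swap_right x v x]
  ring

lemma fderiv_eq : fderiv ℝ P = fun x => (1 / 2 : ℝ) • B x x :=
  funext fun x => (h.hasFDerivAt x).fderiv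

lemma fderiv_fderiv_eq : fderiv ℝ (fderiv ℝ P) = fun x => B x := by
  rw [h.fderiv_eq]
  ext x u v
  have h1 : HasFDerivAt (fun y => (1 / 2 : ℝ) • B y y) _ x :=
    ((B.hasFDerivAt (x := x)).clm_apply (hasFDerivAt_id x)).const_smul (1 / 2 : ℝ)
  rw [h1.fderiv]
  simp
  rw [h.swap_left u x v]
  ring

lemma hess_eq (x u v : A) : hess P x u v = B x u v := by
  rw [hess, iteratedFDeriv_two_apply, h.fderiv_fderiv_eq]
  rfl

lemma third_eq (x u v w : A) : third P x u v w = B u v w := by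
  rw [third, iteratedFDeriv_succ_apply_right, iteratedFDeriv_two_apply]
  change fderiv ℝ (fderiv ℝ (fderiv ℝ P)) x u v w = _
  rw [h.fderiv_fderiv_eq]
  simp

lemma laplacian_eq [FiniteDimensional ℝ A] (x : A) :
    (Laplacian.laplacian P : A → ℝ) x =
      ∑ i, B x (stdOrthonormalBasis ℝ A i) (stdOrthonormalBasis ℝ A i) := by
  rw [InnerProductSpace.laplacian_eq_iteratedFDeriv_stdOrthonormalBasis]
  exact Finset.sum_congr rfl fun i _ => h.hess_eq x _ _

lemma apply_add (x y : A) :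
    P (x + y) = P x + P y + (B x x y + B x y y) / 2 := by
  have h1 := h.apply_diag (x + y)
  have h2 := h.apply_diag x
  have h3 := h.apply_diag y
  simp only [map_add, add_apply] at h1
  have e1 := h.swap_left x y x
  have e2 := h.swap_left x y y
  have e3 := h.swap_right y y x
  have e4 := h.swap_right x y x
  have e5 := h.swap_left y x y
  linarith

end IsPolarization
end
end CubicPoly

/-! ### Sums of cubes of simplex coordinates are solutions -/

namespace CubicPoly
section
variable {A : Type*} [NormedAddCommGroup A] [InnerProductSpace ℝ A]

/-- `J` embeds `A` isometrically into the hyperplane of vectors of coordinate sum zero, and `P` is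
the positive multiple `k` of the sum of the cubes of the coordinates of `J`. -/
structure IsSimplexForm {n : ℕ} (P : A → ℝ) (k : ℝ)
    (J : A →ₗᵢ[ℝ] EuclideanSpace ℝ (Fin (n + 1))) : Prop where
  pos : 0 < k
  sum_eq_zero : ∀ x, ∑ i, J x i = 0
  apply_eq : ∀ x, P x = k * ∑ i, J x i ^ 3

section Frame

variable {n : ℕ} (J : A →ₗᵢ[ℝ] EuclideanSpace ℝ (Fin (n + 1)))

lemma inner_eq_sum_coord (x y : A) : inner ℝ x y = ∑ i, J x i * J y i := by
  rw [← J.inner_map_map, PiLp.inner_apply]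
  exact Finset.sum_congr rfl fun i _ => by simp [mul_comm]

lemma norm_sq_eq_sum_coord (x : A) : ‖x‖ ^ 2 = ∑ i, J x i ^ 2 := by
  rw [← real_inner_self_eq_norm_sq, inner_eq_sum_coord J]
  exact Finset.sum_congr rfl fun i _ => (sq _).symm

lemma eq_of_coord_eq {x y : A} (h : ∀ i, J x i = J y i) : x = y :=
  J.injective (by ext i; exact h i)

/-- The coordinate sum-zero hyperplane is the range of `J`. -/
lemma exists_coord_eq (hA : Module.finrank ℝ A = n) (hJ : ∀ x, ∑ i, J x i = 0)
    (y : Fin (n + 1) → ℝ) (hy : ∑ i, y i = 0) : ∃ x, ∀ i, J x i = y i := by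
  let e : EuclideanSpace ℝ (Fin (n + 1)) := WithLp.toLp 2 fun _ => 1
  have he : e ≠ 0 := fun h => by
    have := congrArg (fun v : EuclideanSpace ℝ (Fin (n + 1)) => v 0) h
    simp [e] at this
  have hmem : ∀ v : EuclideanSpace ℝ (Fin (n + 1)), v ∈ (ℝ ∙ e)ᗮ ↔ ∑ i, v i = 0 := by
    intro v
    rw [Submodule.mem_orthogonal_singleton_iff_inner_right, PiLp.inner_apply]
    simp [e]
  have : Fact (Module.finrank ℝ (EuclideanSpace ℝ (Fin (n + 1))) = n + 1) := ⟨by simp⟩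
  have hle : LinearMap.range J.toLinearMap ≤ (ℝ ∙ e)ᗮ := by
    rintro _ ⟨x, rfl⟩
    exact (hmem _).2 (hJ x)
  have heq : LinearMap.range J.toLinearMap = (ℝ ∙ e)ᗮ := by
    apply Submodule.eq_of_le_of_finrank_eq hle
    rw [Submodule.finrank_orthogonal_span_singleton (n := n) he,
      LinearMap.finrank_range_of_inj J.injective, hA]
  have : WithLp.toLp 2 y ∈ LinearMap.range J.toLinearMap := by
    rw [heq]
    exact (hmem _).2 hy
  obtain ⟨x, hx⟩ := this
  refine ⟨x, fun i => ?_⟩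
  have := congrArg (fun v : EuclideanSpace ℝ (Fin (n + 1)) => v i) hx
  simpa using this

/-- The trilinear form `∑ i, x i * y i * z i` in the coordinates of `J`. -/
noncomputable def tri (x y z : A) : ℝ := ∑ i, J x i * J y i * J z i

variable (hA : Module.finrank ℝ A = n) (hJ : ∀ x, ∑ i, J x i = 0)
include hA hJ

/-- The commutative product that corresponds to `tri`. -/
lemma exists_mul (x y : A) :
    ∃ q : A, (∀ i, J q i = J x i * J y i - inner ℝ x y / (n + 1)) ∧
      ∀ z, tri J x y z = inner ℝ q z := by
  obtain ⟨q, hq⟩ := exists_coord_eq J hA hJ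
    (fun i => J x i * J y i - inner ℝ x y / (n + 1)) (by
      rw [Finset.sum_sub_distrib, ← inner_eq_sum_coord J]
      simp
      field_simp
      ring)
  refine ⟨q, hq, fun z => ?_⟩
  rw [inner_eq_sum_coord J, tri]
  simp_rw [hq, sub_mul]
  rw [Finset.sum_sub_distrib, ← Finset.mul_sum, hJ]
  simp

/-- The vector that represents a coordinate of `J`. -/
lemma exists_coord_vector (i : Fin (n + 1)) :
    ∃ w : A, (∀ l, J w l = (if l = i then 1 else 0) - 1 / (n + 1)) ∧
      ∀ x, inner ℝ w x = J x i := by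
  obtain ⟨w, hw⟩ := exists_coord_eq J hA hJ
    (fun l => (if l = i then 1 else 0) - 1 / (n + 1)) (by
      rw [Finset.sum_sub_distrib]
      simp
      field_simp
      ring)
  refine ⟨w, hw, fun x => ?_⟩
  rw [inner_eq_sum_coord J]
  simp_rw [hw, sub_mul]
  rw [Finset.sum_sub_distrib, ← Finset.mul_sum, hJ]
  simp

variable {ι : Type*} [Fintype ι] (b : OrthonormalBasis ι ℝ A)

/-- Parseval for the products of `x, y` and of `z, w`. The subtracted term is the part of the
coordinatewise products removed by projection to the sum-zero hyperplane. -/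
lemma sum_tri_mul_tri (x y z w : A) :
    ∑ p, tri J x y (b p) * tri J z w (b p) =
      ∑ i, J x i * J y i * J z i * J w i - inner ℝ x y * inner ℝ z w / (n + 1) := by
  obtain ⟨q, hq, hq'⟩ := exists_mul J hA hJ x y
  obtain ⟨r, hr, hr'⟩ := exists_mul J hA hJ z w
  simp_rw [hq', hr']
  have h1 : ∑ p, inner ℝ q (b p) * inner ℝ r (b p) = inner ℝ q r := by
    rw [← b.sum_inner_mul_inner q r]
    exact Finset.sum_congr rfl fun p _ => by rw [real_inner_comm r]
  rw [h1, real_inner_comm, ← hr', tri, inner_eq_sum_coord J x y, Finset.sum_mul, Finset.sum_div,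
    ← Finset.sum_sub_distrib]
  have h2 : ∑ i, J z i * J w i * J q i = ∑ i, (J x i * J y i * J z i * J w i -
      J z i * J w i * (inner ℝ x y / (n + 1))) :=
    Finset.sum_congr rfl fun i _ => by rw [hq]; ring
  rw [h2, Finset.sum_sub_distrib, Finset.sum_sub_distrib, ← Finset.sum_mul,
    ← inner_eq_sum_coord J z w, ← Finset.sum_div, ← Finset.sum_mul, ← inner_eq_sum_coord J x y]
  ring

lemma sum_coord_sq (i : Fin (n + 1)) : ∑ p, J (b p) i ^ 2 = n / (n + 1) := by
  obtain ⟨w, hw, hw'⟩ := exists_coord_vector J hA hJ i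
  simp_rw [← hw', b.sum_sq_inner_left]
  rw [← real_inner_self_eq_norm_sq, hw', hw]
  simp
  field_simp
  ring

lemma sum_tri_diag (x : A) : ∑ p, tri J x (b p) (b p) = 0 := by
  simp only [tri]
  rw [Finset.sum_comm]
  simp_rw [mul_assoc, ← Finset.mul_sum, ← sq, sum_coord_sq J hA hJ, ← Finset.sum_mul, hJ]
  simp

lemma sum_sum_tri_sq (x : A) :
    ∑ p, ∑ q, tri J x (b p) (b q) ^ 2 = (n - 1) / (n + 1) * ‖x‖ ^ 2 := by
  simp_rw [sq (tri J _ _ _), sum_tri_mul_tri J hA hJ]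
  rw [Finset.sum_sub_distrib, Finset.sum_comm, ← Finset.sum_div]
  simp_rw [← sq]
  rw [b.sum_sq_inner_left]
  have : ∀ i p, J x i * J (b p) i * J x i * J (b p) i = J x i ^ 2 * J (b p) i ^ 2 := by
    intros; ring
  simp_rw [this, ← Finset.mul_sum, sum_coord_sq J hA hJ, ← Finset.sum_mul,
    ← norm_sq_eq_sum_coord]
  ring

end Frame

namespace IsSimplexForm

variable {n : ℕ} {P : A → ℝ} {k : ℝ} {J : A →ₗᵢ[ℝ] EuclideanSpace ℝ (Fin (n + 1))}
  (h : IsSimplexForm P k J)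
include h

lemma isCubicForm : IsCubicForm P := by
  refine ⟨(6 * k) • ∑ i, (ContinuousMultilinearMap.mkPiAlgebra ℝ (Fin 3) ℝ).compContinuousLinearMap
    fun _ => (EuclideanSpace.proj (𝕜 := ℝ) i).comp J.toContinuousLinearMap, ?_, ?_⟩
  · intro σ v
    simp only [smul_apply, sum_apply,
      ContinuousMultilinearMap.compContinuousLinearMap_apply,
      ContinuousMultilinearMap.mkPiAlgebra_apply]
    congr 1
    refine Finset.sum_congr rfl fun i _ => ?_
    exact Equiv.prod_comp σ fun j =>
      ((EuclideanSpace.proj (𝕜 := ℝ) i).comp J.toContinuousLinearMap) (v j)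
  · intro x
    simp [h.apply_eq, mul_assoc]

lemma exists_isPolarization : ∃ B, IsPolarization P B ∧
    ∀ x y z, B x y z = 6 * k * tri J x y z := by
  obtain ⟨B, hB⟩ := h.isCubicForm.exists_isPolarization
  refine ⟨B, hB, ?_⟩
  have key : ∀ x y, B x x y = 6 * k * tri J x x y := by
    intro x y
    have e1 := hB.apply_add x y
    have e2 := hB.apply_add x (-y)
    have e3 := h.apply_eq y
    have e4 := h.apply_eq (-y)
    rw [h.apply_eq (x + y), h.apply_eq x] at e1
    rw [h.apply_eq (x + -y), h.apply_eq x] at e2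
    -- By `apply_add`, `P (x + y) - P (x - y) - 2 * P y` isolates `B x x y`.
    have t : k * ∑ i, J (x + y) i ^ 3 - k * ∑ i, J (x + -y) i ^ 3 - 2 * (k * ∑ i, J y i ^ 3) =
        6 * k * tri J x x y := by
      simp only [tri, Finset.mul_sum, ← Finset.sum_sub_distrib]
      refine Finset.sum_congr rfl fun i _ => ?_
      simp
      ring
    have t' : k * ∑ i, J (-y) i ^ 3 = - (k * ∑ i, J y i ^ 3) := by
      simp only [Finset.mul_sum, ← Finset.sum_neg_distrib]
      refine Finset.sum_congr rfl fun i _ => ?_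
      simp
      ring
    simp only [map_neg, neg_apply, neg_neg] at e2
    linarith
  intro x y z
  have e := key (x + y) z
  simp only [map_add, add_apply] at e
  have t : tri J (x + y) (x + y) z = tri J x x z + tri J y y z + 2 * tri J x y z := by
    simp only [tri, Finset.mul_sum, ← Finset.sum_add_distrib]
    refine Finset.sum_congr rfl fun i _ => ?_
    simp
    ring
  have := hB.swap_left x y z
  have := key x z
  have := key y z
  rw [t] at e
  linarith

/-- In the nonassociativity tensor the quartic sums cancel by symmetry. Only the projection terms of
`sum_tri_mul_tri` survive, with coefficient `36 * k ^ 2 / (n + 1) = κ / (n - 1)`. -/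
lemma isConfAssocSolution [FiniteDimensional ℝ A] (hn : 2 ≤ n) (hA : Module.finrank ℝ A = n) :
    IsConfAssocSolution P (36 * k ^ 2 * (n - 1) / (n + 1)) := by
  obtain ⟨B, hB, hBt⟩ := h.exists_isPolarization
  have hJ := h.sum_eq_zero
  have hn' : (0 : ℝ) < n - 1 := by
    have : (2 : ℝ) ≤ n := by exact_mod_cast hn
    linarith
  have hk := h.pos
  refine ⟨⟨h.isCubicForm, by positivity, fun x => ?_, fun x => ?_⟩, fun x u v w z => ?_⟩
  · rw [hB.laplacian_eq]
    simp_rw [hBt]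
    rw [← Finset.mul_sum, sum_tri_diag J hA hJ, mul_zero]
  · rw [hessNormSq]
    simp_rw [hB.hess_eq, hBt, mul_pow _ (tri J _ _ _), ← Finset.mul_sum]
    rw [sum_sum_tri_sq J hA hJ]
    ring
  · rw [nonassoc]
    simp_rw [hB.third_eq, hBt]
    have : ∀ p, 6 * k * tri J z u (stdOrthonormalBasis ℝ A p) *
          (6 * k * tri J v w (stdOrthonormalBasis ℝ A p)) -
        6 * k * tri J z v (stdOrthonormalBasis ℝ A p) *
          (6 * k * tri J u w (stdOrthonormalBasis ℝ A p)) =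
        36 * k ^ 2 * (tri J z u (stdOrthonormalBasis ℝ A p) *
          tri J v w (stdOrthonormalBasis ℝ A p) - tri J z v (stdOrthonormalBasis ℝ A p) *
          tri J u w (stdOrthonormalBasis ℝ A p)) := fun p => by ring
    simp_rw [this]
    rw [← Finset.mul_sum, Finset.sum_sub_distrib, sum_tri_mul_tri J hA hJ,
      sum_tri_mul_tri J hA hJ, hA, real_inner_comm u w, real_inner_comm v w, real_inner_comm v z,
      real_inner_comm u z]
    have t : ∑ i, J z i * J u i * J v i * J w i = ∑ i, J z i * J v i * J u i * J w i :=
      Finset.sum_congr rfl fun i _ => by ring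
    rw [t]
    field_simp
    ring

end IsSimplexForm
end
end CubicPoly

/-! ### Classification by joint diagonalization of the unital extension -/

namespace CubicPoly
section

/-- Commuting symmetric operators have an orthonormal basis of common eigenvectors. -/
lemma exists_orthonormalBasis_joint_eigenvectors {E ι : Type*} [NormedAddCommGroup E]
    [InnerProductSpace ℝ E] [FiniteDimensional ℝ E] {N : ℕ} (hN : Module.finrank ℝ E = N)
    (T : ι → E →ₗ[ℝ] E) (hT : ∀ i, (T i).IsSymmetric) (hC : ∀ i j, Commute (T i) (T j)) :
    ∃ (f : OrthonormalBasis (Fin N) ℝ E) (χ : Fin N → ι → ℝ), ∀ a i, T i (f a) = χ a i • f a := by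
  classical
  let V : (ι → ℝ) → Submodule ℝ E := fun α => ⨅ j, Module.End.eigenspace (T j) (α j)
  have hV : DirectSum.IsInternal V :=
    LinearMap.IsSymmetric.directSum_isInternal_of_pairwise_commute hT fun i j _ => hC i j
  have hO : OrthogonalFamily ℝ (fun i => V i) fun i => (V i).subtypeₗᵢ :=
    LinearMap.IsSymmetric.orthogonalFamily_iInf_eigenspaces hT
  let bas := hV.collectedBasis fun i => (stdOrthonormalBasis ℝ (V i)).toBasis
  have hfin : Finite (Σ i, Fin (Module.finrank ℝ (V i))) := Module.Finite.finite_basis bas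
  have := Fintype.ofFinite (Σ i, Fin (Module.finrank ℝ (V i)))
  have hbas : Orthonormal ℝ bas := by
    have := hO.orthonormal_sigma_orthonormal
      (show ∀ i, Orthonormal ℝ (stdOrthonormalBasis ℝ (V i)).toBasis by simp)
    simpa [bas] using this
  let g := bas.toOrthonormalBasis hbas
  have hcard : Fintype.card (Σ i, Fin (Module.finrank ℝ (V i))) = N := by
    rw [← hN, Module.finrank_eq_card_basis bas]
  refine ⟨g.reindex (Fintype.equivFinOfCardEq hcard),
    fun a => ((Fintype.equivFinOfCardEq hcard).symm a).1, fun a i => ?_⟩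
  have hmem : g ((Fintype.equivFinOfCardEq hcard).symm a) ∈
      V ((Fintype.equivFinOfCardEq hcard).symm a).1 := by
    simp only [g, Module.Basis.coe_toOrthonormalBasis, bas]
    exact hV.collectedBasis_mem _ _
  rw [OrthonormalBasis.reindex_apply]
  exact Module.End.mem_eigenspace_iff.1 ((Submodule.mem_iInf _).1 hmem i)

variable {A : Type*} [NormedAddCommGroup A] [InnerProductSpace ℝ A] [FiniteDimensional ℝ A]

/-- The product on `A` that corresponds to a trilinear form. -/
noncomputable def formMul (B : A →L[ℝ] A →L[ℝ] A →L[ℝ] ℝ) (x : A) : A →ₗ[ℝ] A where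
  toFun y := (InnerProductSpace.toDual ℝ A).symm (B x y)
  map_add' y z := by simp
  map_smul' r y := by simp

lemma inner_formMul (B : A →L[ℝ] A →L[ℝ] A →L[ℝ] ℝ) (x y z : A) :
    inner ℝ (formMul B x y) z = B x y z := by
  simp [formMul]

/-- Multiplication by `x` in the unital extension `A ⊕ ℝ` of the algebra of a trilinear form. -/
noncomputable def extMul (B : A →L[ℝ] A →L[ℝ] A →L[ℝ] ℝ) (s : ℝ) (x : A) :
    WithLp 2 (A × ℝ) →ₗ[ℝ] WithLp 2 (A × ℝ) where
  toFun v := WithLp.toLp 2 (formMul B x v.fst + (s * v.snd) • x, s * inner ℝ x v.fst)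
  map_add' v w := by
    apply WithLp.ofLp_injective
    ext
    · simp [mul_add, add_smul]
      abel
    · simp [inner_add_right, mul_add]
  map_smul' r v := by
    apply WithLp.ofLp_injective
    ext
    · simp [smul_smul, mul_left_comm]
    · simp [inner_smul_right]
      ring

lemma extMul_fst (B : A →L[ℝ] A →L[ℝ] A →L[ℝ] ℝ) (s : ℝ) (x : A) (v : WithLp 2 (A × ℝ)) :
    (extMul B s x v).fst = formMul B x v.fst + (s * v.snd) • x := rfl

lemma extMul_snd (B : A →L[ℝ] A →L[ℝ] A →L[ℝ] ℝ) (s : ℝ) (x : A) (v : WithLp 2 (A × ℝ)) :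
    (extMul B s x v).snd = s * inner ℝ x v.fst := rfl

/-- The terms involving `s` exchange the summands `A` and `ℝ`, so only the trace of `formMul B x`
contributes. -/
lemma trace_extMul (B : A →L[ℝ] A →L[ℝ] A →L[ℝ] ℝ) (s : ℝ) (x : A)
    (hx : ∑ i, B x (stdOrthonormalBasis ℝ A i) (stdOrthonormalBasis ℝ A i) = 0) :
    LinearMap.trace ℝ _ (extMul B s x) = 0 := by
  rw [LinearMap.trace_eq_sum_inner _
    ((stdOrthonormalBasis ℝ A).prod (OrthonormalBasis.singleton Unit ℝ)), Fintype.sum_sum_type]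
  have h1 : ∀ v : WithLp 2 (A × ℝ), inner ℝ v (extMul B s x v) =
      inner ℝ v.fst (extMul B s x v).fst + inner ℝ v.snd (extMul B s x v).snd :=
    fun v => WithLp.prod_inner_apply _ _
  simp only [h1, extMul_fst, extMul_snd]
  simp [real_inner_comm (formMul _ _ _), inner_formMul, hx]

namespace IsPolarization

variable {P : A → ℝ} {B : A →L[ℝ] A →L[ℝ] A →L[ℝ] ℝ} (h : IsPolarization P B)
include h

lemma formMul_comm (x y : A) : formMul B x y = formMul B y x := by
  refine ext_inner_right ℝ fun z => ?_
  rw [inner_formMul, inner_formMul, h.swap_left]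

lemma inner_formMul_left (x y z : A) :
    inner ℝ (formMul B x y) z = inner ℝ y (formMul B x z) := by
  rw [inner_formMul, real_inner_comm, inner_formMul, h.swap_right]

lemma isSymmetric_extMul (s : ℝ) (x : A) : (extMul B s x).IsSymmetric := by
  intro v w
  rw [WithLp.prod_inner_apply, WithLp.prod_inner_apply]
  change inner ℝ (extMul B s x v).fst w.fst + inner ℝ (extMul B s x v).snd w.snd =
    inner ℝ v.fst (extMul B s x w).fst + inner ℝ v.snd (extMul B s x w).snd
  simp only [extMul_fst, extMul_snd, inner_add_left, inner_add_right, h.inner_formMul_left,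
    inner_smul_left, inner_smul_right, real_inner_comm x, RCLike.inner_apply, conj_trivial]
  ring

/-- The detour `A → ℝ → A` contributes `s * s * ⟪v, z⟫ • u` to the composite, which is exactly the
curvature defect of associativity when `s * s = c`. -/
lemma commute_extMul {s c : ℝ} (hs : s * s = c)
    (hc : ∀ u v w z, inner ℝ (formMul B z u) (formMul B v w) -
      inner ℝ (formMul B z v) (formMul B u w) =
      c * (inner ℝ w u * inner ℝ v z - inner ℝ w v * inner ℝ u z)) (u v : A) :
    Commute (extMul B s u) (extMul B s v) := by
  have key : ∀ z, formMul B u (formMul B v z) + (c * inner ℝ v z) • u =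
      formMul B v (formMul B u z) + (c * inner ℝ u z) • v := by
    intro z
    refine ext_inner_right ℝ fun w => ?_
    have := hc u v w z
    rw [h.formMul_comm z u, h.formMul_comm z v] at this
    simp only [inner_add_left, inner_smul_left, h.inner_formMul_left _ (formMul B _ _),
      conj_trivial]
    rw [real_inner_comm w u, real_inner_comm w v]
    linarith
  refine LinearMap.ext fun x => ?_
  rw [Module.End.mul_apply, Module.End.mul_apply]
  apply WithLp.ofLp_injective
  refine Prod.ext ?_ ?_
  · change (extMul B s u _).fst = (extMul B s v _).fst
    have := key x.fst
    simp only [extMul_fst, extMul_snd, map_add, map_smul, ← mul_assoc, hs]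
    rw [h.formMul_comm v u]
    rw [add_right_comm, this, add_right_comm]
  · change (extMul B s u _).snd = (extMul B s v _).snd
    simp only [extMul_fst, extMul_snd, inner_add_right, inner_smul_right]
    rw [real_inner_comm u v, ← h.inner_formMul_left, ← h.inner_formMul_left, h.formMul_comm u v]

end IsPolarization

/-- A conformally associative solution is the sum of the cubes of the coordinates with respect to
the vertices of a regular simplex. -/
lemma IsConfAssocSolution.exists_isSimplexForm {P : A → ℝ} {κ : ℝ} {n : ℕ}
    (h : IsConfAssocSolution P κ) (hn : 2 ≤ n) (hA : Module.finrank ℝ A = n) :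
    ∃ (k : ℝ) (J : A →ₗᵢ[ℝ] EuclideanSpace ℝ (Fin (n + 1))), IsSimplexForm P k J := by
  obtain ⟨B, hB⟩ := h.solution.cubic.exists_isPolarization
  have hn' : (0 : ℝ) < n - 1 := by
    have : (2 : ℝ) ≤ n := by exact_mod_cast hn
    linarith
  -- Positivity makes the real square root `s` of `κ / (n - 1)` available.
  have hκ : 0 < κ := by
    have : Nontrivial A := Module.nontrivial_of_finrank_pos (R := ℝ) (by omega)
    obtain ⟨x, hx⟩ := exists_ne (0 : A)
    have h1 := h.solution.hess_sq x
    have h2 : 0 ≤ hessNormSq P x :=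
      Finset.sum_nonneg fun i _ => Finset.sum_nonneg fun j _ => sq_nonneg _
    have h3 : 0 < ‖x‖ ^ 2 := by positivity
    refine lt_of_le_of_ne ?_ h.solution.kappa_ne_zero.symm
    rw [h1] at h2
    exact nonneg_of_mul_nonneg_left h2 h3
  obtain ⟨c, hc⟩ : ∃ c, c = κ / ((n : ℝ) - 1) := ⟨_, rfl⟩
  have hc0 : 0 < c := hc ▸ div_pos hκ hn'
  obtain ⟨s, hs⟩ : ∃ s, s = √c := ⟨_, rfl⟩
  have hs0 : 0 < s := hs ▸ Real.sqrt_pos.2 hc0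
  have hss : s * s = c := hs ▸ Real.mul_self_sqrt hc0.le
  have hassoc : ∀ u v w z, inner ℝ (formMul B z u) (formMul B v w) -
      inner ℝ (formMul B z v) (formMul B u w) =
      c * (inner ℝ w u * inner ℝ v z - inner ℝ w v * inner ℝ u z) := by
    intro u v w z
    have h1 := h.confAssoc 0 u v w z
    have hcA : κ / ((Module.finrank ℝ A : ℝ) - 1) = c := by rw [hA, hc]
    rw [nonassoc, hcA] at h1
    rw [← h1, Finset.sum_sub_distrib, ← (stdOrthonormalBasis ℝ A).sum_inner_mul_inner,
      ← (stdOrthonormalBasis ℝ A).sum_inner_mul_inner]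
    simp only [hB.third_eq, inner_formMul, real_inner_comm (formMul B v w),
      real_inner_comm (formMul B u w)]
  have htr : ∀ x, LinearMap.trace ℝ _ (extMul B s x) = 0 := fun x =>
    trace_extMul B s x (by rw [← hB.laplacian_eq]; exact h.solution.harmonic x)
  obtain ⟨f, χ, hf⟩ := exists_orthonormalBasis_joint_eigenvectors (N := n + 1)
    (by rw [(WithLp.linearEquiv 2 ℝ (A × ℝ)).finrank_eq]; simp [hA])
    (extMul B s) (hB.isSymmetric_extMul s) (hB.commute_extMul hss hassoc)
  have hf2 : ∀ i x, s * inner ℝ x (f i).fst = χ i x * (f i).snd := fun i x =>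
    congrArg WithLp.snd (hf i x)
  have horth : ∀ i j, inner ℝ (f i).fst (f j).fst + (f i).snd * (f j).snd =
      if i = j then 1 else 0 := by
    intro i j
    rw [← orthonormal_iff_ite.1 f.orthonormal i j, WithLp.prod_inner_apply]
    simp [mul_comm]
  have hχsum : ∀ x, ∑ i, χ i x = 0 := by
    intro x
    rw [← htr x, LinearMap.trace_eq_sum_inner _ f]
    refine Finset.sum_congr rfl fun i _ => ?_
    rw [hf, inner_smul_right, orthonormal_iff_ite.1 f.orthonormal]
    simp
  have hij : ∀ i j, χ i (f j).fst * (f i).snd = s * ((if i = j then 1 else 0) -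
      (f i).snd * (f j).snd) := by
    intro i j
    rw [← hf2, ← horth, real_inner_comm]
    ring
  -- A vanishing scalar component would turn `hij i i` into `0 = s`.
  have hne : ∀ i, (f i).snd ≠ 0 := by
    intro i hi
    have := hij i i
    simp only [hi, mul_zero, if_true, sub_zero, mul_one] at this
    exact hs0.ne this
  -- With `ε = (f j).snd`, dividing `hij` by `(f i).snd` and summing over `i` gives `s * (1 / ε - (n
  -- + 1) * ε)`, which is zero by tracelessness.
  have hε : ∀ j, (f j).snd ^ 2 = 1 / (n + 1) := by
    intro j
    have h1 : ∀ i, χ i (f j).fst = s * ((if i = j then 1 / (f j).snd else 0) - (f j).snd) := by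
      intro i
      apply mul_right_cancel₀ (hne i)
      rw [hij]
      split_ifs with hh
      · subst hh
        field_simp [hne i]
      · ring
    have h2 := hχsum (f j).fst
    simp_rw [h1] at h2
    rw [← Finset.mul_sum, Finset.sum_sub_distrib] at h2
    have h3 := hne j
    simp [hs0.ne'] at h2
    field_simp at h2 ⊢
    linarith
  have hχ : ∀ i x, χ i x = s * inner ℝ x (f i).fst / (f i).snd := fun i x => by
    rw [hf2, mul_div_cancel_right₀ _ (hne i)]
  have hfx : ∀ (x : A) i, inner ℝ (f i) (WithLp.toLp 2 (x, (0 : ℝ))) = inner ℝ x (f i).fst := by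
    intro x i
    rw [WithLp.prod_inner_apply]
    simp [real_inner_comm]
  have hpars : ∀ x : A, ∑ i, inner ℝ x (f i).fst ^ 2 = ‖x‖ ^ 2 := by
    intro x
    have h1 := f.sum_sq_inner_right (WithLp.toLp 2 (x, (0 : ℝ)))
    simp_rw [hfx] at h1
    rw [h1, WithLp.prod_norm_sq_eq_of_L2]
    simp
  have hε' : ∀ i, √((n : ℝ) + 1) ^ 2 * (f i).snd ^ 2 = 1 := fun i => by
    rw [hε, Real.sq_sqrt (by positivity)]
    field_simp
  obtain ⟨r, hr⟩ : ∃ r, r = √((n : ℝ) + 1) := ⟨_, rfl⟩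
  have hr0 : 0 < r := hr ▸ Real.sqrt_pos.2 (by positivity)
  rw [← hr] at hε'
  have hinv : ∀ i, ((f i).snd)⁻¹ ^ 2 = r ^ 2 := fun i => by
    rw [inv_pow]
    exact (eq_inv_of_mul_eq_one_left (hε' i)).symm
  -- The factor `((f i).snd)⁻¹ * r⁻¹` is a sign. It makes every coordinate the same positive
  -- multiple of the eigenvalue `χ i`, so one positive `k` serves all cubes.
  let J : A →ₗᵢ[ℝ] EuclideanSpace ℝ (Fin (n + 1)) :=
    { toFun := fun x => WithLp.toLp 2 fun i => inner ℝ x (f i).fst * (((f i).snd)⁻¹ * r⁻¹)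
      map_add' := fun x y => by
        ext i
        simp [inner_add_left, add_mul]
      map_smul' := fun a x => by
        ext i
        simp [inner_smul_left, mul_assoc]
      norm_map' := fun x => by
        refine (sq_eq_sq₀ (norm_nonneg _) (norm_nonneg _)).1 ?_
        change ‖(WithLp.toLp 2 fun i => inner ℝ x (f i).fst * (((f i).snd)⁻¹ * r⁻¹) :
          EuclideanSpace ℝ (Fin (n + 1)))‖ ^ 2 = _
        rw [EuclideanSpace.real_norm_sq_eq, ← hpars]
        refine Finset.sum_congr rfl fun i _ => ?_
        simp only [mul_pow, hinv]
        field_simp }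
  have hJ : ∀ x i, J x i = χ i x * (s⁻¹ * r⁻¹) := fun x i => by
    change inner ℝ x (f i).fst * (((f i).snd)⁻¹ * r⁻¹) = _
    rw [hχ]
    field_simp
  refine ⟨s * r / 6, J, by positivity, fun x => ?_, fun x => ?_⟩
  · simp_rw [hJ]
    rw [← Finset.sum_mul, hχsum, zero_mul]
  · have h1 : B x x x = ∑ i, χ i x * inner ℝ x (f i).fst ^ 2 := by
      have e1 : B x x x = inner ℝ (extMul B s x (WithLp.toLp 2 (x, (0 : ℝ))))
          (WithLp.toLp 2 (x, (0 : ℝ))) := by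
        rw [WithLp.prod_inner_apply]
        change _ = inner ℝ (extMul B s x _).fst x + inner ℝ _ (0 : ℝ)
        simp [extMul_fst, inner_formMul]
      rw [e1, ← f.sum_inner_mul_inner]
      refine Finset.sum_congr rfl fun i _ => ?_
      rw [hB.isSymmetric_extMul, hf, inner_smul_right, real_inner_comm (f i), hfx]
      ring
    have h2 := hB.apply_diag x
    have h3 : s * r / 6 * ∑ i, J x i ^ 3 = (1 / 6) * ∑ i, χ i x * inner ℝ x (f i).fst ^ 2 := by
      rw [Finset.mul_sum, Finset.mul_sum]
      refine Finset.sum_congr rfl fun i _ => ?_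
      have h4 : J x i ^ 2 = inner ℝ x (f i).fst ^ 2 := by
        change (inner ℝ x (f i).fst * (((f i).snd)⁻¹ * r⁻¹)) ^ 2 = _
        simp only [mul_pow, hinv]
        field_simp
      rw [pow_succ, h4, hJ]
      field_simp
    rw [h3, ← h1]
    linarith

end
end CubicPoly

/-! ### `P_n` as a sum of cubes -/

namespace CubicPoly
section

/-- The coordinates, in terms of orthonormal coordinates `x 0, …, x (m - 1)` of the hyperplane of
sum zero, of a point with respect to the vertices of the standard simplex. -/
noncomputable def vertexCoord (x : ℕ → ℝ) : ℕ → ℕ → ℝ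
  | 0, _ => 0
  -- With `t = x m / √((m + 1) * (m + 2))`, the new entry is `(m + 1) * t` and the `m + 1` old ones
  -- drop by `t`: the sum stays zero and the sum of squares grows by `(m + 1) * (m + 2) * t ^ 2 = x
  -- m ^ 2`.
  | m + 1, i => if i = m + 1 then (m + 1) * (x m / √(((m : ℝ) + 1) * (m + 2)))
      else vertexCoord x m i - x m / √(((m : ℝ) + 1) * (m + 2))

lemma sum_vertexCoord_succ (x : ℕ → ℝ) (m : ℕ) (f : ℝ → ℝ) :
    ∑ i ∈ Finset.range (m + 2), f (vertexCoord x (m + 1) i) =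
      ∑ i ∈ Finset.range (m + 1), f (vertexCoord x m i - x m / √(((m : ℝ) + 1) * (m + 2))) +
        f ((m + 1) * (x m / √(((m : ℝ) + 1) * (m + 2)))) := by
  rw [Finset.sum_range_succ]
  congr 1
  · refine Finset.sum_congr rfl fun i hi => ?_
    rw [vertexCoord, if_neg (Finset.mem_range.1 hi).ne]
  · rw [vertexCoord, if_pos rfl]

lemma sum_vertexCoord (x : ℕ → ℝ) (m : ℕ) :
    ∑ i ∈ Finset.range (m + 1), vertexCoord x m i = 0 := by
  induction m with
  | zero => simp [vertexCoord]
  | succ m ih =>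
    rw [sum_vertexCoord_succ x m fun t => t, Finset.sum_sub_distrib, ih]
    simp

lemma sq_div_sqrt (a : ℝ) (m : ℕ) :
    (a / √(((m : ℝ) + 1) * (m + 2))) ^ 2 * ((m + 1) * (m + 2)) = a ^ 2 := by
  rw [div_pow, Real.sq_sqrt (by positivity)]
  field_simp

lemma sum_vertexCoord_sq (x : ℕ → ℝ) (m : ℕ) :
    ∑ i ∈ Finset.range (m + 1), vertexCoord x m i ^ 2 = ∑ j ∈ Finset.range m, x j ^ 2 := by
  induction m with
  | zero => simp [vertexCoord]
  | succ m ih =>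
    rw [sum_vertexCoord_succ x m fun t => t ^ 2, Finset.sum_range_succ (fun j => x j ^ 2) m, ← sq_div_sqrt (x m) m]
    generalize x m / √(((m : ℝ) + 1) * (m + 2)) = t
    simp_rw [sub_sq]
    rw [Finset.sum_add_distrib, Finset.sum_sub_distrib, ih, ← Finset.sum_mul, ← Finset.mul_sum,
      sum_vertexCoord]
    simp
    ring

lemma sum_vertexCoord_cube (x : ℕ → ℝ) (m : ℕ) :
    ∑ i ∈ Finset.range (m + 1), vertexCoord x m i ^ 3 =
      ∑ j ∈ Finset.range m, 1 / √(((j : ℝ) + 1) * (j + 2)) *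
        ∑ i ∈ Finset.range j, (x j ^ 3 - 3 * x j * x i ^ 2) := by
  induction m with
  | zero => simp [vertexCoord]
  | succ m ih =>
    rw [sum_vertexCoord_succ x m fun t => t ^ 3]
    conv_rhs => rw [Finset.sum_range_succ, ← ih]
    rw [Finset.sum_sub_distrib, ← Finset.mul_sum, ← sum_vertexCoord_sq]
    have hq := sq_div_sqrt (x m) m
    have e : ∀ s : ℝ, 1 / √(((m : ℝ) + 1) * (m + 2)) * (∑ i ∈ Finset.range m, x m ^ 3 - 3 * x m * s)
        = (x m / √(((m : ℝ) + 1) * (m + 2))) * (m * x m ^ 2 - 3 * s) := by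
      intro s
      simp
      ring
    rw [e, ← hq]
    generalize x m / √(((m : ℝ) + 1) * (m + 2)) = t
    have c : ∀ i, (vertexCoord x m i - t) ^ 3 = vertexCoord x m i ^ 3 -
        3 * t * vertexCoord x m i ^ 2 + 3 * t ^ 2 * vertexCoord x m i - t ^ 3 := fun i => by ring
    simp_rw [c]
    rw [Finset.sum_sub_distrib, Finset.sum_add_distrib, Finset.sum_sub_distrib, ← Finset.mul_sum,
      ← Finset.mul_sum, sum_vertexCoord]
    simp
    ring

lemma vertexCoord_add (x y : ℕ → ℝ) (m i : ℕ) :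
    vertexCoord (x + y) m i = vertexCoord x m i + vertexCoord y m i := by
  induction m with
  | zero => simp [vertexCoord]
  | succ m ih =>
    simp only [vertexCoord, ih, Pi.add_apply]
    split_ifs <;> ring

lemma vertexCoord_smul (c : ℝ) (x : ℕ → ℝ) (m i : ℕ) :
    vertexCoord (c • x) m i = c * vertexCoord x m i := by
  induction m with
  | zero => simp [vertexCoord]
  | succ m ih =>
    simp only [vertexCoord, ih, Pi.smul_apply, smul_eq_mul]
    split_ifs <;> ring

variable {A : Type*} [NormedAddCommGroup A] [InnerProductSpace ℝ A] {n : ℕ}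
  (b : OrthonormalBasis (Fin n) ℝ A)

/-- The coordinates in an orthonormal basis, extended by zero to a sequence. -/
noncomputable def coordSeq (x : A) (j : ℕ) : ℝ := if h : j < n then b.repr x ⟨j, h⟩ else 0

lemma coordSeq_val (x : A) (j : Fin n) : coordSeq b x j = b.repr x j := by
  simp [coordSeq]

lemma coordSeq_add (x y : A) : coordSeq b (x + y) = coordSeq b x + coordSeq b y := by
  ext j
  simp only [coordSeq, Pi.add_apply]
  split_ifs <;> simp

lemma coordSeq_smul (c : ℝ) (x : A) : coordSeq b (c • x) = c • coordSeq b x := by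
  ext j
  simp only [coordSeq, Pi.smul_apply]
  split_ifs <;> simp

/-- The standard isometry onto the hyperplane of sum zero. -/
noncomputable def stdFrame : A →ₗᵢ[ℝ] EuclideanSpace ℝ (Fin (n + 1)) where
  toFun x := WithLp.toLp 2 fun i => vertexCoord (coordSeq b x) n i
  map_add' x y := by
    ext i
    simp [coordSeq_add, vertexCoord_add]
  map_smul' c x := by
    ext i
    simp [coordSeq_smul, vertexCoord_smul]
  norm_map' x := by
    have h1 : ‖(WithLp.toLp 2 fun i : Fin (n + 1) => vertexCoord (coordSeq b x) n i :
        EuclideanSpace ℝ (Fin (n + 1)))‖ ^ 2 = ‖x‖ ^ 2 := by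
      rw [EuclideanSpace.real_norm_sq_eq, ← b.repr.norm_map x, EuclideanSpace.real_norm_sq_eq]
      simp only
      rw [← Finset.sum_range fun i => vertexCoord (coordSeq b x) n i ^ 2, sum_vertexCoord_sq,
        Finset.sum_range]
      simp_rw [coordSeq_val]
    exact (sq_eq_sq₀ (norm_nonneg _) (norm_nonneg _)).1 h1

lemma isSimplexForm_simplicial (hn : 0 < n) :
    IsSimplexForm (simplicial b) (√((n : ℝ) * (n + 1)) / 6) (stdFrame b) := by
  refine ⟨by positivity, fun x => ?_, fun x => ?_⟩
  · change ∑ i : Fin (n + 1), vertexCoord (coordSeq b x) n i = 0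
    rw [← Finset.sum_range fun i => vertexCoord (coordSeq b x) n i, sum_vertexCoord]
  · change _ = _ * ∑ i : Fin (n + 1), vertexCoord (coordSeq b x) n i ^ 3
    rw [← Finset.sum_range fun i => vertexCoord (coordSeq b x) n i ^ 3, sum_vertexCoord_cube,
      simplicial, Finset.sum_range]
    congr 1
    refine Finset.sum_congr rfl fun j _ => ?_
    congr 1
    rw [← Nat.Iio_eq_range, ← Fin.map_valEmbedding_Iio, Finset.sum_map]
    refine Finset.sum_congr rfl fun i _ => ?_
    simp [coordSeq_val]

end
end CubicPoly

/-! ### The orbit, indecomposability and critical points -/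

namespace CubicPoly
section
variable {A : Type*} [NormedAddCommGroup A] [InnerProductSpace ℝ A]

/-- Two isometric embeddings onto the hyperplane of sum zero differ by an isometry. -/
lemma exists_isometryEquiv_coord_eq [FiniteDimensional ℝ A] {n : ℕ}
    (hA : Module.finrank ℝ A = n) (J K : A →ₗᵢ[ℝ] EuclideanSpace ℝ (Fin (n + 1)))
    (hJ : ∀ x, ∑ i, J x i = 0) (hK : ∀ x, ∑ i, K x i = 0) :
    ∃ o : A ≃ₗᵢ[ℝ] A, ∀ x i, J (o x) i = K x i := by
  choose o ho using fun x => exists_coord_eq J hA hJ (fun i => K x i) (hK x)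
  let o' : A →ₗᵢ[ℝ] A :=
    { toFun := o
      map_add' := fun x y => eq_of_coord_eq J fun i => by simp [ho]
      map_smul' := fun c x => eq_of_coord_eq J fun i => by simp [ho]
      norm_map' := fun x => by
        change ‖o x‖ = ‖x‖
        rw [← J.norm_map, ← K.norm_map]
        congr 1
        ext i
        exact ho x i }
  exact ⟨o'.toLinearIsometryEquiv rfl, fun x i => ho x i⟩

namespace IsSimplexForm

variable {n : ℕ} {P Q : A → ℝ} {k l : ℝ} {J K : A →ₗᵢ[ℝ] EuclideanSpace ℝ (Fin (n + 1))}

lemma mem_orbit [FiniteDimensional ℝ A] (h : IsSimplexForm P k J) (h' : IsSimplexForm Q l K)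
    (hA : Module.finrank ℝ A = n) : Q ∈ orbit P := by
  obtain ⟨o, ho⟩ := exists_isometryEquiv_coord_eq hA J K h.sum_eq_zero h'.sum_eq_zero
  have hk := h.pos
  have hl := h'.pos
  -- The isometry matches the frames; the homothety by this cube root matches the factors.
  obtain ⟨r, hr0, hr⟩ : ∃ r : ℝ, 0 < r ∧ r ^ 3 = l / k :=
    ⟨(l / k) ^ (((3 : ℕ) : ℝ)⁻¹), by positivity,
      Real.rpow_inv_natCast_pow (by positivity) (by norm_num)⟩
  let g : A ≃ₗ[ℝ] A := o.toLinearEquiv.trans (LinearEquiv.smulOfNeZero ℝ A r hr0.ne')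
  have hg : ∀ x, g x = r • o x := fun x => rfl
  refine ⟨g⁻¹, inv_mem ⟨r, o, hr0.ne', hg⟩, ?_⟩
  ext x
  rw [inv_inv, hg, h.apply_eq, h'.apply_eq]
  simp only [map_smul, PiLp.smul_apply, smul_eq_mul, mul_pow, ho, hr, ← Finset.mul_sum]
  field_simp

lemma of_mem_orbit (h : IsSimplexForm P k J) (hQ : Q ∈ orbit P) :
    ∃ (l : ℝ) (K : A →ₗᵢ[ℝ] EuclideanSpace ℝ (Fin (n + 1))), IsSimplexForm Q l K := by
  obtain ⟨g, hg, rfl⟩ := hQ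
  obtain ⟨r, o, hr, ho⟩ := inv_mem hg
  have hk := h.pos
  -- A negative ratio is absorbed by composing with `-1`, which keeps the factor positive.
  rcases lt_or_gt_of_ne hr with hr | hr
  · refine ⟨k * (-r) ^ 3, J.comp (o.trans (LinearIsometryEquiv.neg ℝ)).toLinearIsometry,
      mul_pos hk (pow_pos (neg_pos.2 hr) 3), fun x => h.sum_eq_zero _, fun x => ?_⟩
    simp only [ho, h.apply_eq, Finset.mul_sum]
    refine Finset.sum_congr rfl fun i _ => ?_
    simp
    ring
  · refine ⟨k * r ^ 3, J.comp o.toLinearIsometry,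
      mul_pos hk (pow_pos hr 3), fun x => h.sum_eq_zero _, fun x => ?_⟩
    simp only [ho, h.apply_eq, Finset.mul_sum]
    refine Finset.sum_congr rfl fun i _ => ?_
    simp
    ring

/-- A splitting kills all mixed values of `B`. For nonzero `x ∈ U`, `y ∈ Uᗮ` the product of `x` and
`y` then vanishes, and since `x ⟂ y` their coordinates have disjoint supports. The product `z` of
`x` with itself lies in `U`, so `tri J z y y = 0`; but disjointness gives `-‖x‖ ^ 2 * ‖y‖ ^ 2 / (n +
1)`. -/
lemma orthIndecomposable [FiniteDimensional ℝ A] (h : IsSimplexForm P k J)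
    (hA : Module.finrank ℝ A = n) : OrthIndecomposable P := by
  rintro ⟨U, hU, hU', hdec⟩
  have hJ := h.sum_eq_zero
  obtain ⟨B, hB, hBt⟩ := h.exists_isPolarization
  have hk : 6 * k ≠ 0 := mul_ne_zero (by norm_num) h.pos.ne'
  have hBz : ∀ {x y z}, B x y z = 0 → tri J x y z = 0 := fun {x y z} hh => by
    rw [hBt] at hh
    exact (mul_eq_zero.1 hh).resolve_left hk
  have h0 : ∀ x ∈ U, ∀ y ∈ Uᗮ, B x x y + B x y y = 0 := fun x hx y hy => by
    have := hB.apply_add x y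
    rw [hdec x hx y hy] at this
    linarith
  have h1 : ∀ x ∈ U, ∀ y ∈ Uᗮ, B x x y = 0 ∧ B x y y = 0 := fun x hx y hy => by
    have e1 := h0 x hx y hy
    have e2 := h0 x hx (-y) (neg_mem hy)
    simp only [map_neg, neg_apply, neg_neg] at e2
    constructor <;> linarith
  have h2 : ∀ x ∈ U, ∀ x' ∈ U, ∀ y ∈ Uᗮ, B x x' y = 0 := fun x hx x' hx' y hy => by
    have e1 := (h1 (x + x') (add_mem hx hx') y hy).1
    have e2 := (h1 x hx y hy).1
    have e3 := (h1 x' hx' y hy).1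
    have e4 := hB.swap_left x x' y
    simp only [map_add, add_apply] at e1
    linarith
  have h3 : ∀ x ∈ U, ∀ y ∈ Uᗮ, ∀ y' ∈ Uᗮ, B x y y' = 0 := fun x hx y hy y' hy' => by
    have e1 := (h1 x hx (y + y') (add_mem hy hy')).2
    have e2 := (h1 x hx y hy).2
    have e3 := (h1 x hx y' hy').2
    have e4 := hB.swap_right x y y'
    simp only [map_add, add_apply] at e1
    linarith
  obtain ⟨x, hx, hx0⟩ := U.exists_mem_ne_zero_of_ne_bot hU
  obtain ⟨y, hy, hy0⟩ := Uᗮ.exists_mem_ne_zero_of_ne_bot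
    (fun hh => hU' (U.orthogonal_eq_bot_iff.1 hh))
  have hxy : inner ℝ x y = 0 := hy x hx
  obtain ⟨q, hq, hq'⟩ := exists_mul J hA hJ x y
  have hq0 : q = 0 := by
    have e1 : q ∈ Uᗮ := fun u hu => by
      rw [real_inner_comm, ← hq']
      exact hBz (by rw [hB.swap_right]; exact h2 x hx u hu y hy)
    have e2 : q ∈ Uᗮᗮ := fun u hu => by
      rw [real_inner_comm, ← hq']
      exact hBz (h3 x hx y hy u hu)
    exact inner_self_eq_zero.1 (e2 q e1)
  have hprod : ∀ i, J x i * J y i = 0 := fun i => by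
    have := hq i
    rw [hq0, hxy] at this
    simpa using this.symm
  obtain ⟨z, hz, hz'⟩ := exists_mul J hA hJ x x
  have hzU : z ∈ U := by
    rw [← U.orthogonal_orthogonal]
    intro u hu
    rw [real_inner_comm, ← hz']
    exact hBz (h1 x hx u hu).1
  have e := hBz (h1 z hzU y hy).2
  rw [tri] at e
  have e' : ∀ i, J z i * J y i * J y i = - (inner ℝ x x / (n + 1)) * J y i ^ 2 := fun i => by
    rw [hz, sub_mul, mul_assoc (J x i), hprod i]
    ring
  simp_rw [e'] at e
  rw [← Finset.mul_sum, ← norm_sq_eq_sum_coord, real_inner_self_eq_norm_sq] at e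
  have p1 : 0 < ‖x‖ := norm_pos_iff.2 hx0
  have p2 : 0 < ‖y‖ := norm_pos_iff.2 hy0
  have : 0 < ‖x‖ ^ 2 / (n + 1) * ‖y‖ ^ 2 := by positivity
  linarith

end IsSimplexForm

lemma image_sphereCritical {P : A → ℝ} {g : A ≃ₗᵢ[ℝ] A} (hg : g ∈ Aut P) :
    g '' sphereCritical P = sphereCritical P := by
  have key : ∀ g ∈ Aut P, ∀ v ∈ sphereCritical P, g v ∈ sphereCritical P := by
    intro g hg v hv
    refine ⟨by rw [g.norm_map, hv.1], fun w hw => ?_⟩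
    have h1 : P ∘ g = P := funext hg
    have h2 := g.toContinuousLinearEquiv.comp_right_fderiv (f := P) (x := v)
    change fderiv ℝ (P ∘ g) v = _ at h2
    rw [h1] at h2
    have h3 := hv.2 (g.symm w) (by rw [← g.inner_map_map, g.apply_symm_apply, hw])
    rw [h2] at h3
    simpa using h3
  refine Set.Subset.antisymm (Set.image_subset_iff.2 fun v hv => key g hg v hv) fun v hv => ?_
  exact ⟨g⁻¹ v, key g⁻¹ (inv_mem hg) v hv, g.apply_symm_apply v⟩

end
end CubicPoly

/-! ### Maxima on the sphere and the automorphism group -/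

namespace CubicPoly
section
variable {A : Type*} [NormedAddCommGroup A] [InnerProductSpace ℝ A]

lemma Aut.map_mem_sphereMaxima {P : A → ℝ} {g : A ≃ₗᵢ[ℝ] A} (hg : g ∈ Aut P) {v : A}
    (hv : v ∈ sphereMaxima P) : g v ∈ sphereMaxima P :=
  ⟨by rw [g.norm_map, hv.1], fun w hw => by rw [hg v]; exact hv.2 w hw⟩

namespace IsSimplexForm

variable {n : ℕ} {P : A → ℝ} {k : ℝ} {J : A →ₗᵢ[ℝ] EuclideanSpace ℝ (Fin (n + 1))}
  (h : IsSimplexForm P k J)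
include h

/-- The maxima on the unit sphere are the vertices of a regular simplex. -/
lemma exists_vertices (hn : 2 ≤ n) (hA : Module.finrank ℝ A = n) :
    ∃ (a : ℝ) (v : Fin (n + 1) → A), 0 < a ∧
      (∀ i l, J (v i) l = if l = i then a else - a / n) ∧ (∀ i x, J x i = a * inner ℝ (v i) x) ∧
      Set.range v = sphereMaxima P := by
  have hJ := h.sum_eq_zero
  have hn0 : (0 : ℝ) < n := by exact_mod_cast (by omega : 0 < n)
  -- Coordinates `a` once and `-a / n` in the other `n` places have norm one for this `a`.
  obtain ⟨a, ha⟩ : ∃ a, a = √((n : ℝ) / (n + 1)) := ⟨_, rfl⟩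
  have ha0 : 0 < a := ha ▸ Real.sqrt_pos.2 (by positivity)
  have ha2 : a ^ 2 = n / (n + 1) := by rw [ha, Real.sq_sqrt (by positivity)]
  have hite : ∀ i l : Fin (n + 1), (if l = i then a else - a / n) =
      (if l = i then a + a / n else 0) - a / n := fun i l => by
    split_ifs <;> ring
  choose v hv using fun i : Fin (n + 1) => exists_coord_eq J hA hJ
    (fun l => if l = i then a else - a / n) (by
      simp_rw [hite]
      rw [Finset.sum_sub_distrib]
      simp
      field_simp
      ring)
  have hin : ∀ i x, J x i = a * inner ℝ (v i) x := by
    intro i x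
    rw [inner_eq_sum_coord J]
    simp_rw [hv, hite, sub_mul]
    rw [Finset.sum_sub_distrib, ← Finset.mul_sum, hJ]
    simp
    have : a * (a + a / n) = 1 := by
      have : a * (a + a / n) = a ^ 2 * (1 + 1 / n) := by ring
      rw [this, ha2]
      field_simp
    rw [← mul_assoc, this, one_mul]
  have hnorm : ∀ i, ‖v i‖ = 1 := by
    intro i
    have h1 := hin i (v i)
    rw [hv, if_pos rfl, real_inner_self_eq_norm_sq] at h1
    have : ‖v i‖ ^ 2 = 1 := by
      apply mul_left_cancel₀ ha0.ne'
      linarith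
    exact (pow_eq_one_iff_of_nonneg (norm_nonneg _) two_ne_zero).1 this
  -- The cubic `(a - t) * (t + a / n) ^ 2` is nonnegative for `t ≤ a`. As `∑ t_i = 0` and `∑ t_i ^ 2
  -- = 1`, its sum is a constant minus `∑ t_i ^ 3`, so maxima have all coordinates in `{a, -a / n}`.
  have hid : ∀ x, ‖x‖ = 1 → ∑ i, J x i ^ 3 + ∑ i, (a - J x i) * (J x i + a / n) ^ 2 =
      a * (1 - 2 / n) + (n + 1) * (a ^ 3 / n ^ 2) := by
    intro x hx
    have e : ∀ i, (a - J x i) * (J x i + a / n) ^ 2 = a ^ 3 / n ^ 2 +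
        (2 * a ^ 2 / n - a ^ 2 / n ^ 2) * J x i + (a * (1 - 2 / n)) * J x i ^ 2 - J x i ^ 3 :=
      fun i => by ring
    simp_rw [e]
    rw [Finset.sum_sub_distrib, Finset.sum_add_distrib, Finset.sum_add_distrib, ← Finset.mul_sum,
      ← Finset.mul_sum, hJ, ← norm_sq_eq_sum_coord, hx]
    simp
    ring
  have hterm : ∀ x, ‖x‖ = 1 → ∀ i, 0 ≤ (a - J x i) * (J x i + a / n) ^ 2 := by
    intro x hx i
    refine mul_nonneg (sub_nonneg.2 ?_) (sq_nonneg _)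
    have := real_inner_le_norm (v i) x
    rw [hnorm, hx, one_mul] at this
    rw [hin]
    exact mul_le_of_le_one_right ha0.le this
  have hmax : ∀ i, v i ∈ sphereMaxima P := by
    intro i
    refine ⟨hnorm i, fun w hw => ?_⟩
    rw [h.apply_eq, h.apply_eq]
    refine mul_le_mul_of_nonneg_left ?_ h.pos.le
    have e1 := hid w hw
    have e2 := hid (v i) (hnorm i)
    have e3 : ∑ l, (a - J (v i) l) * (J (v i) l + a / n) ^ 2 = 0 := by
      refine Finset.sum_eq_zero fun l _ => ?_
      rw [hv]
      split_ifs <;> ring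
    have e4 := Finset.sum_nonneg fun i (_ : i ∈ Finset.univ) => hterm w hw i
    linarith
  refine ⟨a, v, ha0, hv, hin, Set.Subset.antisymm (Set.range_subset_iff.2 hmax) fun x hx => ?_⟩
  have e0 := hx.2 (v 0) (hnorm 0)
  rw [h.apply_eq, h.apply_eq] at e0
  have e0 := le_of_mul_le_mul_left e0 h.pos
  have e1 := hid x hx.1
  have e2 := hid (v 0) (hnorm 0)
  have e3 : ∑ l, (a - J (v 0) l) * (J (v 0) l + a / n) ^ 2 = 0 := by
    refine Finset.sum_eq_zero fun l _ => ?_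
    rw [hv]
    split_ifs <;> ring
  have e4 : ∑ l, (a - J x l) * (J x l + a / n) ^ 2 = 0 :=
    le_antisymm (by linarith) (Finset.sum_nonneg fun i _ => hterm x hx.1 i)
  have e5 := (Finset.sum_eq_zero_iff_of_nonneg fun i _ => hterm x hx.1 i).1 e4
  -- Coordinates all equal to `-a / n` would not sum to zero. One coordinate `a` means `⟪v i, x⟫ =
  -- 1`, the equality case of Cauchy–Schwarz.
  obtain ⟨i, hi⟩ : ∃ i, J x i = a := by
    by_contra! hcon
    have e6 : ∀ i, J x i = - (a / n) := fun i => by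
      rcases mul_eq_zero.1 (e5 i (Finset.mem_univ i)) with e7 | e7
      · exact absurd (sub_eq_zero.1 e7).symm (hcon i)
      · exact eq_neg_of_add_eq_zero_left (pow_eq_zero_iff two_ne_zero |>.1 e7)
    have e8 := hJ x
    simp_rw [e6] at e8
    have : 0 < ((n : ℝ) + 1) * (a / n) := by positivity
    simp at e8
    rcases e8 with e8 | e8
    · linarith
    · rcases e8 with e8 | e8
      · exact ha0.ne' e8
      · omega
  refine ⟨i, (inner_eq_one_iff_of_norm_eq_one (𝕜 := ℝ) (hnorm i) hx.1).1 ?_⟩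
  rw [hin] at hi
  exact mul_left_cancel₀ ha0.ne' (by linarith)

/-- The automorphism group is the symmetric group on the maxima on the unit sphere. -/
lemma aut_eq_symmetric [FiniteDimensional ℝ A] (hn : 2 ≤ n) (hA : Module.finrank ℝ A = n) :
    ∃ (v : Fin (n + 1) → A) (φ : Aut P ≃* Equiv.Perm (Fin (n + 1))),
      Function.Injective v ∧ Set.range v = sphereMaxima P ∧
      (∀ (g : Aut P) (i : Fin (n + 1)), (g : A ≃ₗᵢ[ℝ] A) (v i) = v (φ g i)) ∧
      ∀ i j : Fin (n + 1), i ≠ j → (∀ x ∈ Submodule.span ℝ {v i - v j}, P x = 0) ∧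
        ((φ.symm (Equiv.swap i j) : Aut P) : A ≃ₗᵢ[ℝ] A) = hyperplaneReflection (v i - v j) := by
  obtain ⟨a, v, ha0, hv, hin, hrange⟩ := h.exists_vertices hn hA
  have hn0 : (0 : ℝ) < n := by exact_mod_cast (by omega : 0 < n)
  have hinj : Function.Injective v := by
    intro i j hij
    by_contra hne
    have h1 := hv i i
    rw [hij, hv, if_neg hne, if_pos rfl] at h1
    have : 0 < a / n := by positivity
    rw [neg_div] at h1
    linarith
  have hmem : ∀ i, v i ∈ sphereMaxima P := fun i => hrange ▸ Set.mem_range_self i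
  have hmap : ∀ (g : Aut P) i, ∃ j, (g : A ≃ₗᵢ[ℝ] A) (v i) = v j := fun g i => by
    obtain ⟨j, hj⟩ := hrange.symm ▸ Aut.map_mem_sphereMaxima g.2 (hmem i)
    exact ⟨j, hj.symm⟩
  choose p hp using hmap
  let f : Aut P →* Function.End (Fin (n + 1)) :=
    { toFun := p
      map_one' := funext fun i => hinj ((hp 1 i).symm)
      map_mul' := fun g g' => funext fun i => hinj (by
        rw [← hp (g * g') i]
        change (g : A ≃ₗᵢ[ℝ] A) ((g' : A ≃ₗᵢ[ℝ] A) (v i)) = v (p g (p g' i))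
        rw [hp g' i, hp g]) }
  have hf : ∀ g i, f.toHomPerm g i = p g i := fun g i => rfl
  -- Coordinates are inner products with the `v i` up to the factor `a`, so an isometry fixing all
  -- `v i` preserves them.
  have hfix : ∀ g : A ≃ₗᵢ[ℝ] A, (∀ i, g (v i) = v i) → g = 1 := by
    intro g hg
    ext x
    refine eq_of_coord_eq J fun i => ?_
    rw [hin, hin]
    nth_rewrite 1 [← hg i]
    rw [g.inner_map_map]
    rfl
  have huniq : ∀ g g' : A ≃ₗᵢ[ℝ] A, (∀ i, g (v i) = g' (v i)) → g = g' := by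
    intro g g' hg
    refine (inv_mul_eq_one.1 (hfix (g'⁻¹ * g) fun i => ?_)).symm
    change g'.symm (g (v i)) = v i
    rw [hg, g'.symm_apply_apply]
  have hbij : Function.Bijective f.toHomPerm := by
    constructor
    · intro g g' hgg
      refine Subtype.ext (huniq _ _ fun i => ?_)
      rw [hp, hp, ← hf, ← hf, hgg]
    · intro σ
      -- Permuting the coordinates by `σ` preserves the sum-zero hyperplane and the sum of cubes.
      obtain ⟨o, ho⟩ := exists_isometryEquiv_coord_eq hA J
        ((LinearIsometryEquiv.piLpCongrLeft 2 ℝ ℝ σ).toLinearIsometry.comp J) h.sum_eq_zero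
        (fun x => by
          change ∑ i, J x (σ.symm i) = 0
          rw [Equiv.sum_comp σ.symm fun i => J x i]
          exact h.sum_eq_zero x)
      have ho' : ∀ x i, J (o x) i = J x (σ.symm i) := fun x i => ho x i
      have hoP : o ∈ Aut P := fun x => by
        rw [h.apply_eq, h.apply_eq]
        simp_rw [ho']
        rw [Equiv.sum_comp σ.symm fun i => J x i ^ 3]
      refine ⟨⟨o, hoP⟩, ?_⟩
      ext1 i
      apply hinj
      rw [hf, ← hp]
      refine eq_of_coord_eq J fun l => ?_
      change J (o (v i)) l = _
      rw [ho', hv, hv]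
      simp [Equiv.symm_apply_eq]
  let φ := MulEquiv.ofBijective f.toHomPerm hbij
  have hφ : ∀ (g : Aut P) i, (g : A ≃ₗᵢ[ℝ] A) (v i) = v (φ g i) := hp
  have hrefl : ∀ i j, i ≠ j → ((φ.symm (Equiv.swap i j) : Aut P) : A ≃ₗᵢ[ℝ] A) =
      hyperplaneReflection (v i - v j) := by
    intro i j hij
    refine huniq _ _ fun l => ?_
    rw [hφ, φ.apply_symm_apply, hyperplaneReflection]
    have hnorm : ‖v i‖ = ‖v j‖ := by rw [(hmem i).1, (hmem j).1]
    have hi := Submodule.reflection_sub hnorm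
    by_cases hli : l = i
    · rw [hli, Equiv.swap_apply_left, hi]
    by_cases hlj : l = j
    · rw [hlj, Equiv.swap_apply_right]
      exact (congrArg _ hi).symm.trans (Submodule.reflection_reflection _ _) |>.symm
    -- Any other vertex has `i`-th and `j`-th coordinates both `-a / n`, so it is orthogonal to `v i
    -- - v j`.
    · rw [Equiv.swap_apply_of_ne_of_ne hli hlj, Submodule.reflection_mem_subspace_eq_self]
      rw [Submodule.mem_orthogonal_singleton_iff_inner_right, inner_sub_left]
      apply mul_left_cancel₀ ha0.ne'
      rw [mul_sub, ← hin, ← hin, hv, hv, if_neg (Ne.symm hli), if_neg (Ne.symm hlj)]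
      simp
  refine ⟨v, φ, hinj, hrange, hφ, fun i j hij => ⟨fun x hx => ?_, hrefl i j hij⟩⟩
  obtain ⟨c, rfl⟩ := Submodule.mem_span_singleton.1 hx
  -- The reflection preserves `P` but negates this line, and `P` is odd.
  have h1 := (φ.symm (Equiv.swap i j)).2 (c • (v i - v j))
  rw [hrefl i j hij, hyperplaneReflection, map_smul,
    Submodule.reflection_orthogonalComplement_singleton_eq_neg] at h1
  have h2 : ∀ y, P (-y) = - P y := fun y => by
    rw [h.apply_eq, h.apply_eq, ← mul_neg, ← Finset.sum_neg_distrib]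
    congr 1
    refine Finset.sum_congr rfl fun l _ => ?_
    simp
    ring
  rw [smul_neg, h2] at h1
  linarith

end IsSimplexForm

/-- If the transpositions of the maxima are induced by reflections, these generate. -/
lemma aut_eq_closure {P : A → ℝ} {n : ℕ} {v : Fin (n + 1) → A}
    (φ : Aut P ≃* Equiv.Perm (Fin (n + 1))) (hinj : Function.Injective v)
    (hrange : Set.range v = sphereMaxima P)
    (hrefl : ∀ i j : Fin (n + 1), i ≠ j →
      ((φ.symm (Equiv.swap i j) : Aut P) : A ≃ₗᵢ[ℝ] A) = hyperplaneReflection (v i - v j)) :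
    Aut P = Subgroup.closure {s | ∃ y ∈ sphereMaxima P, ∃ z ∈ sphereMaxima P, y ≠ z ∧
      s = hyperplaneReflection (y - z)} := by
  refine le_antisymm (fun g hg => ?_) ((Subgroup.closure_le _).2 ?_)
  · have key : ∀ σ, ((φ.symm σ : Aut P) : A ≃ₗᵢ[ℝ] A) ∈ Subgroup.closure
        {s | ∃ y ∈ sphereMaxima P, ∃ z ∈ sphereMaxima P, y ≠ z ∧
          s = hyperplaneReflection (y - z)} := by
      intro σ
      induction σ using Equiv.Perm.swap_induction_on with
      | one => simp
      | swap_mul σ i j hij ih =>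
        rw [map_mul, Subgroup.coe_mul]
        refine mul_mem (Subgroup.subset_closure ?_) ih
        exact ⟨v i, hrange ▸ Set.mem_range_self i, v j, hrange ▸ Set.mem_range_self j,
          hinj.ne hij, hrefl i j hij⟩
    simpa using key (φ ⟨g, hg⟩)
  · rintro s ⟨y, hy, z, hz, hyz, rfl⟩
    rw [← hrange] at hy hz
    obtain ⟨i, rfl⟩ := hy
    obtain ⟨j, rfl⟩ := hz
    rw [← hrefl i j fun hh => hyz (hh ▸ rfl)]
    exact (φ.symm (Equiv.swap i j)).2

end
end CubicPoly

theorem mainTheorem3 {A : Type*} [NormedAddCommGroup A] [InnerProductSpace ℝ A]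
    [FiniteDimensional ℝ A] (n : ℕ) (hn : 2 ≤ n) (b : OrthonormalBasis (Fin n) ℝ A) :
    CubicPoly.IsConfAssocSolution (CubicPoly.simplicial b) ((n : ℝ) * ((n : ℝ) - 1)) ∧
    {P : A → ℝ | ∃ κ : ℝ, CubicPoly.IsConfAssocSolution P κ} =
      CubicPoly.orbit (CubicPoly.simplicial b) ∧
    ∀ P ∈ CubicPoly.orbit (CubicPoly.simplicial b),
      CubicPoly.OrthIndecomposable P ∧
      (∀ g ∈ CubicPoly.Aut P, g '' CubicPoly.sphereCritical P = CubicPoly.sphereCritical P) ∧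
      CubicPoly.Aut P = Subgroup.closure
        {s | ∃ y ∈ CubicPoly.sphereMaxima P, ∃ z ∈ CubicPoly.sphereMaxima P, y ≠ z ∧
          s = CubicPoly.hyperplaneReflection (y - z)} ∧
      ∃ (v : Fin (n + 1) → A) (φ : CubicPoly.Aut P ≃* Equiv.Perm (Fin (n + 1))),
        Function.Injective v ∧
        Set.range v = CubicPoly.sphereMaxima P ∧
        (∀ (g : CubicPoly.Aut P) (i : Fin (n + 1)), (g : A ≃ₗᵢ[ℝ] A) (v i) = v (φ g i)) ∧
        ∀ i j : Fin (n + 1), i ≠ j →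
          (∀ x ∈ Submodule.span ℝ {v i - v j}, P x = 0) ∧
          ((φ.symm (Equiv.swap i j) : CubicPoly.Aut P) : A ≃ₗᵢ[ℝ] A) =
            CubicPoly.hyperplaneReflection (v i - v j) := by
  have hA : Module.finrank ℝ A = n := by
    rw [Module.finrank_eq_card_basis b.toBasis, Fintype.card_fin]
  have hS := CubicPoly.isSimplexForm_simplicial b (by omega)
  refine ⟨?_, Set.Subset.antisymm ?_ ?_, fun P hP => ?_⟩
  · have h1 := hS.isConfAssocSolution hn hA
    have h2 : 36 * (√((n : ℝ) * (n + 1)) / 6) ^ 2 * (n - 1) / (n + 1) =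
        (n : ℝ) * ((n : ℝ) - 1) := by
      rw [div_pow, Real.sq_sqrt (by positivity)]
      field_simp
      norm_num
    rwa [h2] at h1
  · rintro P ⟨κ, hP⟩
    obtain ⟨k, J, hJ⟩ := hP.exists_isSimplexForm hn hA
    exact hS.mem_orbit hJ hA
  · intro P hP
    obtain ⟨k, J, hJ⟩ := hS.of_mem_orbit hP
    exact ⟨_, hJ.isConfAssocSolution hn hA⟩
  · obtain ⟨k, J, hJ⟩ := hS.of_mem_orbit hP
    obtain ⟨v, φ, hinj, hrange, hφ, hpair⟩ := hJ.aut_eq_symmetric hn hA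
    exact ⟨hJ.orthIndecomposable hA, fun g hg => CubicPoly.image_sphereCritical hg,
      CubicPoly.aut_eq_closure φ hinj hrange fun i j hij => (hpair i j hij).2,
      v, φ, hinj, hrange, hφ, hpair⟩
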